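/- For each integer $t \ge 0$, let $$Q_t(x) = x^{4t+7} - x^{4t+5} - x^{4t+4} + 2x^{2t+4} + x^{2t+3} + x^{2t+2} + x^{2t} - 2x^{t+3} - x^2 - 1 \in \mathbb{Q}[x].$$ For each integer $b \ge 1$, let $\Phi_b(x) = \prod_{\zeta} (x - \zeta)$ be the $b$-th cyclotomic polynomial, where $\zeta$ ranges over the primitive $b$-th roots of unity in $\mathbb{C}$; it has integer coefficients. Then for every integer $t \ge 0$ and every integer $b \ge 2$, the polynomial $\Phi_b(x)$ does not divide $Q_t(x)$ in $\mathbb{Q}[x]$. -/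

import Mathlib

open Polynomial

/-- The polynomial `Q_t(x)`, as an element of `ℚ[x]`. -/
noncomputable def auxQ (t : ℕ) : ℚ[X] :=
  X ^ (4 * t + 7) - X ^ (4 * t + 5) - X ^ (4 * t + 4) + 2 * X ^ (2 * t + 4) + X ^ (2 * t + 3)
    + X ^ (2 * t + 2) + X ^ (2 * t) - 2 * X ^ (t + 3) - X ^ 2 - 1

/-! Write b = 2^k m with m odd and reduce mod 2. If m > 1, `auxQInt t` vanishes at every primitive
m-th root z in characteristic 2. It is quadratic in Y = z^(2t); eliminating Y between the equations
at z and z⁻¹ gives g(z) = 0 for a fixed g of degree 12. As g ∣ x^65 - 1, m ∣ 65, so z^3 is also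
primitive; but g(x) and g(x^3) are coprime. If m = 1, the points -1 and 1 suffice. -/

/-- The polynomial `Q_t(x)` with integer coefficients. -/
noncomputable def auxQInt (t : ℕ) : ℤ[X] :=
  X ^ (4 * t + 7) - X ^ (4 * t + 5) - X ^ (4 * t + 4) + 2 * X ^ (2 * t + 4) + X ^ (2 * t + 3)
    + X ^ (2 * t + 2) + X ^ (2 * t) - 2 * X ^ (t + 3) - X ^ 2 - 1

theorem auxQInt_map (t : ℕ) : (auxQInt t).map (Int.castRingHom ℚ) = auxQ t := by
  simp [auxQInt, auxQ]

theorem cyclotomic_int_dvd_auxQInt {t b : ℕ} (h : cyclotomic b ℚ ∣ auxQ t) :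
    cyclotomic b ℤ ∣ auxQInt t := by
  rw [← auxQInt_map, ← map_cyclotomic_int] at h
  exact (map_dvd_map _ Int.cast_injective (cyclotomic.monic b ℤ)).1 h

theorem cyclotomic_dvd_auxQInt_map {t b : ℕ} (h : cyclotomic b ℚ ∣ auxQ t)
    (R : Type*) [CommRing R] : cyclotomic b R ∣ (auxQInt t).map (Int.castRingHom R) := by
  rw [← map_cyclotomic_int]
  exact Polynomial.map_dvd _ (cyclotomic_int_dvd_auxQInt h)

theorem eval_auxQInt_map {R : Type*} [CommRing R] (t : ℕ) (x : R) :
    ((auxQInt t).map (Int.castRingHom R)).eval x =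
      (x ^ t) ^ 4 * (x ^ 7 - x ^ 5 - x ^ 4) + (x ^ t) ^ 2 * (2 * x ^ 4 + x ^ 3 + x ^ 2 + 1)
        - 2 * x ^ t * x ^ 3 - x ^ 2 - 1 := by
  simp [auxQInt]
  ring

section CharTwo

variable {K : Type*} [Field K] [CharP K 2]

/-- Eliminating `Y` from the reduction of `Q_t` modulo `2` and its reciprocal. -/
theorem eliminant_eq_zero {x Y : K} (hx : x ≠ 0) (hx1 : x ≠ 1) (hY : Y ≠ 0)
    (h₁ : (x ^ 7 + x ^ 5 + x ^ 4) * Y ^ 2 + (x ^ 3 + x ^ 2 + 1) * Y + (x ^ 2 + 1) = 0)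
    (h₂ : (x ^ 7 + x ^ 5) * Y ^ 2 + (x ^ 7 + x ^ 5 + x ^ 4) * Y + (x ^ 3 + x ^ 2 + 1) = 0) :
    x ^ 12 + x ^ 10 + x ^ 9 + x ^ 8 + x ^ 6 + x ^ 4 + x ^ 3 + x ^ 2 + 1 = 0 := by
  have two : (2 : K) = 0 := CharTwo.two_eq_zero
  -- The resultant of two quadratics, signs dropped in characteristic 2.
  have key : ∀ a b c a' b' c' : K, a * Y ^ 2 + b * Y + c = 0 → a' * Y ^ 2 + b' * Y + c' = 0 →
      (a * c' + a' * c) ^ 2 + (a * b' + a' * b) * (b * c' + b' * c) = 0 := by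
    intro a b c a' b' c' h h'
    have e₁ : (a * b' + a' * b) * Y + (a * c' + a' * c) = 0 := by
      linear_combination a' * h + a * h' - a * a' * Y ^ 2 * two
    have e₂ : (a * c' + a' * c) * Y + (b * c' + b' * c) = 0 := by
      refine (mul_eq_zero.1 ?_).resolve_right hY
      linear_combination c' * h + c * h' - c * c' * two
    linear_combination (a * c' + a' * c) * e₁ + (a * b' + a' * b) * e₂
      - (a * b' + a' * b) * (a * c' + a' * c) * Y * two
  have h := key _ _ _ _ _ _ h₁ h₂
  have hx1' : x + 1 ≠ 0 := fun h0 => hx1 (by linear_combination h0 - two)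
  have hprod : x ^ 5 * (x + 1) ^ 6 *
      (x ^ 12 + x ^ 10 + x ^ 9 + x ^ 8 + x ^ 6 + x ^ 4 + x ^ 3 + x ^ 2 + 1) = 0 := by
    linear_combination h - (- 3*x^22 - 6*x^21 - 11*x^20 - 12*x^19 - 14*x^18 - 10*x^17 + 2*x^15 + 17*x^14 + 2*x^13 -
      10*x^11 - 14*x^10 - 12*x^9 - 11*x^8 - 6*x^7 - 3*x^6) * two
  exact (mul_eq_zero.1 hprod).resolve_left (mul_ne_zero (pow_ne_zero _ hx) (pow_ne_zero _ hx1'))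

theorem pow_sixtyFive_eq_one {x : K}
    (h : x ^ 12 + x ^ 10 + x ^ 9 + x ^ 8 + x ^ 6 + x ^ 4 + x ^ 3 + x ^ 2 + 1 = 0) :
    x ^ 65 = 1 := by
  have two : (2 : K) = 0 := CharTwo.two_eq_zero
  linear_combination (x^53 + x^51 + x^50 + x^47 + x^46 + x^45 + x^43 + x^40 + x^37 + x^36 + x^34 + x^32 + x^28
      + x^25 + x^21 + x^19 + x^17 + x^16 + x^13 + x^10 + x^8 + x^7 + x^6 + x^3 + x^2 + 1) * h
    - (x^63 + x^62 + x^61 + x^60 + 2*x^59 + x^58 + 2*x^57 + 2*x^56 + 3*x^55 + 2*x^54 + 3*x^53 +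
      2*x^52 + 2*x^51 + 2*x^50 + 3*x^49 + 2*x^48 + 2*x^47 + 3*x^46 + 2*x^45 + 2*x^44 + 2*x^43
      + 2*x^42 + x^41 + 3*x^40 + x^39 + 2*x^38 + 2*x^37 + 2*x^36 + x^35 + 2*x^34 + x^33 + x^32
      + 2*x^31 + x^30 + 2*x^29 + 2*x^28 + 2*x^27 + x^26 + 3*x^25 + x^24 + 2*x^23 + 2*x^22 +
      2*x^21 + 2*x^20 + 3*x^19 + 2*x^18 + 2*x^17 + 3*x^16 + 2*x^15 + 2*x^14 + 2*x^13 + 3*x^12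
      + 2*x^11 + 3*x^10 + 2*x^9 + 2*x^8 + x^7 + 2*x^6 + x^5 + x^4 + x^3 + x^2 + 1) * two

/-- A Bézout identity mod 2; the multiple of `two` absorbs the even integer coefficients. -/
theorem eliminant_cube_ne_zero {x : K}
    (h : x ^ 12 + x ^ 10 + x ^ 9 + x ^ 8 + x ^ 6 + x ^ 4 + x ^ 3 + x ^ 2 + 1 = 0) :
    (x ^ 3) ^ 12 + (x ^ 3) ^ 10 + (x ^ 3) ^ 9 + (x ^ 3) ^ 8 + (x ^ 3) ^ 6 + (x ^ 3) ^ 4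
      + (x ^ 3) ^ 3 + (x ^ 3) ^ 2 + 1 ≠ 0 := by
  intro h3
  have two : (2 : K) = 0 := CharTwo.two_eq_zero
  refine one_ne_zero (α := K) ?_
  linear_combination (x^33 + x^32 + x^31 + x^30 + x^29 + x^28 + x^27 + x^26 + x^23 + x^22 + x^19 + x^17 + x^16
      + x^15 + x^13 + x^11 + x^7 + x^4 + x^2 + x + 1) * h
    + (x^9 + x^8 + x^6 + x) * h3
    - (x^45 + x^44 + x^43 + 2*x^42 + 2*x^41 + 2*x^40 + 3*x^39 + 3*x^38 + 3*x^37 + 4*x^36 +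
      4*x^35 + 3*x^34 + 4*x^33 + 4*x^32 + 4*x^31 + 3*x^30 + 3*x^29 + 3*x^28 + 3*x^27 + 3*x^26
      + 4*x^25 + 2*x^24 + 3*x^23 + 2*x^22 + 3*x^21 + 2*x^20 + 4*x^19 + 2*x^18 + 3*x^17 +
      2*x^16 + 3*x^15 + 2*x^14 + 3*x^13 + 2*x^12 + 2*x^11 + 3*x^10 + 2*x^9 + 2*x^8 + 2*x^7 +
      2*x^6 + x^5 + 2*x^4 + x^3 + x^2 + x) * two

theorem not_forall_isPrimitiveRoot_eval_auxQInt_eq_zero {m t : ℕ} (hm : 1 < m) {x : K}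
    (hx : IsPrimitiveRoot x m) : ¬ ∀ z : K, IsPrimitiveRoot z m →
      ((auxQInt t).map (Int.castRingHom K)).eval z = 0 := by
  intro H
  have two : (2 : K) = 0 := CharTwo.two_eq_zero
  have hg : ∀ z : K, IsPrimitiveRoot z m →
      z ^ 12 + z ^ 10 + z ^ 9 + z ^ 8 + z ^ 6 + z ^ 4 + z ^ 3 + z ^ 2 + 1 = 0 := by
    intro z hz
    have hz0 : z ≠ 0 := hz.ne_zero (by omega)
    have h₁ := H z hz
    have h₂ := H z⁻¹ hz.inv
    rw [eval_auxQInt_map] at h₁ h₂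
    rw [inv_pow] at h₂
    have hy0 : z ^ t ≠ 0 := pow_ne_zero _ hz0
    generalize z ^ t = y at h₁ h₂ hy0
    refine eliminant_eq_zero hz0 (hz.ne_one hm) (pow_ne_zero 2 hy0) ?_ ?_
    · linear_combination h₁ + (y ^ 4 * (z ^ 5 + z ^ 4) - y ^ 2 * z ^ 4 + y * z ^ 3 + z ^ 2 + 1) * two
    · field_simp at h₂
      linear_combination h₂ + (z ^ 2 + z ^ 3 - z ^ 3 * y ^ 2 + z ^ 4 * y ^ 3 + z ^ 5 * y ^ 4
        + z ^ 7 * y ^ 4) * two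
  have hx65 := hx.dvd_of_pow_eq_one 65 (pow_sixtyFive_eq_one (hg x hx))
  have hcop : Nat.Coprime 3 m := Nat.Coprime.coprime_dvd_right hx65 (by norm_num)
  exact eliminant_cube_ne_zero (hg x hx) (hg _ (hx.pow_of_coprime 3 hcop))

end CharTwo

theorem not_cyclotomic_two_dvd_auxQ (t : ℕ) : ¬ cyclotomic 2 ℚ ∣ auxQ t := by
  intro h
  have h' := cyclotomic_dvd_auxQInt_map h ℚ
  rw [cyclotomic_two] at h'
  have h0 := eval_dvd (x := (-1 : ℚ)) h'
  rw [eval_auxQInt_map] at h0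
  -- The value at -1 is 2(-1)^t.
  rcases neg_one_pow_eq_or ℚ t with ht | ht <;> rw [ht] at h0 <;> norm_num at h0

theorem not_cyclotomic_two_pow_dvd_auxQ (t k : ℕ) : ¬ cyclotomic (2 ^ (k + 2)) ℚ ∣ auxQ t := by
  intro h
  have h' := cyclotomic_dvd_auxQInt_map h (ZMod 2)
  have hc := cyclotomic_mul_prime_pow_eq (ZMod 2) (p := 2) (m := 1) (by norm_num)
    (k := k + 2) (by omega)
  rw [mul_one, cyclotomic_one] at hc
  rw [hc] at h'
  have hle : 2 ≤ 2 ^ (k + 2) - 2 ^ (k + 2 - 1) := by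
    have : 0 < 2 ^ k := by positivity
    simp only [pow_succ, show k + 2 - 1 = k + 1 by omega]
    omega
  -- Mod 2, 1 would be a double root, yet the derivative there is odd.
  obtain ⟨q, hq⟩ := (pow_dvd_pow _ hle).trans h'
  have two : (2 : ZMod 2) = 0 := by decide
  have four : (4 : ZMod 2) = 0 := by decide
  have hd := congrArg (fun p => (derivative p).eval 1) hq
  simp [auxQInt, derivative_pow, two, four] at hd
  revert hd
  decide

theorem mainTheorem12 (t b : ℕ) (hb : 2 ≤ b) : ¬ (cyclotomic b ℚ ∣ auxQ t) := by
  intro h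
  obtain ⟨k, m, hm, rfl⟩ := Nat.exists_eq_two_pow_mul_odd (n := b) (by omega)
  rcases (Nat.succ_le_of_lt hm.pos).eq_or_lt with rfl | hm1
  · match k, hb, h with
    | 0, hb, _ => simp at hb
    | 1, _, h => exact not_cyclotomic_two_dvd_auxQ t h
    | k + 2, _, h => exact not_cyclotomic_two_pow_dvd_auxQ t k (by simpa using h)
  · let K := AlgebraicClosure (ZMod 2)
    have hm0 : (m : K) ≠ 0 := by
      rw [Ne, CharP.cast_eq_zero_iff K 2]
      exact hm.not_two_dvd_nat
    have : NeZero (m : K) := ⟨hm0⟩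
    obtain ⟨x, hx⟩ := IsAlgClosed.exists_root (cyclotomic m K)
      (by rw [degree_cyclotomic]; exact_mod_cast (Nat.totient_pos.2 hm.pos).ne')
    refine not_forall_isPrimitiveRoot_eval_auxQInt_eq_zero (t := t) hm1
      (isRoot_cyclotomic_iff.1 hx) fun z hz => ?_
    exact IsRoot.dvd ((isRoot_cyclotomic_prime_pow_mul_iff_of_charP (p := 2) (k := k)).2 hz)
      (cyclotomic_dvd_auxQInt_map h K)
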